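/- Let $\nu\ge 2$ and let $\Omega\subset\mathbb R^\nu$ be a bounded Lipschitz domain, that is, a nonempty bounded open set (connected or not) whose boundary is locally, in suitable orthonormal coordinates, the graph of a Lipschitz function with $\Omega$ lying locally on one side of it. For $p\in(1,\infty)$ and $\alpha\in\mathbb R$ put $$\Lambda(\Omega,p,\alpha):=\inf_{\substack{u\in W^{1,p}(\Omega)\\ u\not\equiv 0}}\frac{\displaystyle\int_\Omega|\nabla u|^p\,dx-\alpha\int_{\partial\Omega}|u|^p\,d\sigma}{\displaystyle\int_\Omega|u|^p\,dx},$$ where $\sigma$ is the surface measure (the normalized $(\nu-1)$-dimensional Hausdorff measure) on $\partial\Omega$, functions are real-valued, $u$ on $\partial\Omega$ is understood as the boundary trace of $u$, and the infimum is taken in $[-\infty,+\infty]$. Then $$\Lambda(\Omega,p,\alpha)\le(1-p)\,\alpha^{\frac{p}{p-1}}\qquad\text{for all }\alpha\ge 0\text{ and }p\in(1,\infty).$$ -/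

import Mathlib

open MeasureTheory

noncomputable section

namespace Robin

/-- Euclidean space of dimension `ν`. -/
abbrev Space (ν : ℕ) : Type := EuclideanSpace ℝ (Fin ν)

/-- The boundary of `Ω` is Lipschitz: near each boundary point there is a unit vector `e` such that
`Ω` is the strict epigraph, in the direction `e`, of a Lipschitz function `h` defined on the
hyperplane orthogonal to `e`. -/
def HasLipschitzBoundary {ν : ℕ} (Ω : Set (Space ν)) : Prop :=
  ∀ x ∈ frontier Ω, ∃ (e : Space ν) (h : (ℝ ∙ e)ᗮ → ℝ) (K : NNReal) (U : Set (Space ν)),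
    ‖e‖ = 1 ∧ LipschitzWith K h ∧ IsOpen U ∧ x ∈ U ∧
      Ω ∩ U = {y ∈ U | h ((ℝ ∙ e)ᗮ.orthogonalProjectionOnto y) < inner ℝ e y}

/-- Bounded Lipschitz domains: nonempty bounded open sets with Lipschitz boundary
(connectedness is not required). -/
structure IsBoundedLipschitzDomain {ν : ℕ} (Ω : Set (Space ν)) : Prop where
  isOpen : IsOpen Ω
  nonempty : Ω.Nonempty
  isBounded : Bornology.IsBounded Ω
  lipschitz : HasLipschitzBoundary Ω

/-- Lebesgue measure on `Ω`. -/
def volumeOn {ν : ℕ} (Ω : Set (Space ν)) : Measure (Space ν) := volume.restrict Ω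

/-- The surface measure on the boundary of `Ω`: the `(ν - 1)`-dimensional Hausdorff measure,
normalized so as to agree with Lebesgue measure in dimension `ν - 1`, restricted to `∂Ω`. -/
def surfaceMeasure {ν : ℕ} (Ω : Set (Space ν)) : Measure (Space ν) :=
  (μHE[ν - 1]).restrict (frontier Ω)

/-- `G` is the weak (distributional) gradient of `u` in `Ω`. -/
def IsWeakGradient {ν : ℕ} (Ω : Set (Space ν)) (u : Space ν → ℝ) (G : Space ν → Space ν) : Prop :=
  ∀ φ : Space ν → ℝ, ContDiff ℝ ((⊤ : ℕ∞) : WithTop ℕ∞) φ → HasCompactSupport φ → tsupport φ ⊆ Ω →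
    ∀ v : Space ν,
      ∫ x, u x * fderiv ℝ φ x v ∂volumeOn Ω = - ∫ x, φ x * inner ℝ (G x) v ∂volumeOn Ω

/-- `u` belongs to the Sobolev space `W^{1,p}(Ω)`, with weak gradient `G`. -/
structure MemSobolev {ν : ℕ} (Ω : Set (Space ν)) (p : ℝ) (u : Space ν → ℝ)
    (G : Space ν → Space ν) : Prop where
  memLp : MemLp u (ENNReal.ofReal p) (volumeOn Ω)
  memLp_gradient : MemLp G (ENNReal.ofReal p) (volumeOn Ω)
  isWeakGradient : IsWeakGradient Ω u G

/-- `g ∈ L^p(∂Ω)` is the boundary trace of the Sobolev function `u` with weak gradient `G`: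
some sequence of smooth functions on `ℝ^ν` converges to `u` in `W^{1,p}(Ω)`, and its pointwise
restrictions to `∂Ω` converge to `g` in `L^p(∂Ω)`. -/
def IsBoundaryTrace {ν : ℕ} (Ω : Set (Space ν)) (p : ℝ) (u : Space ν → ℝ)
    (G : Space ν → Space ν) (g : Space ν → ℝ) : Prop :=
  MemLp g (ENNReal.ofReal p) (surfaceMeasure Ω) ∧
  ∃ φ : ℕ → Space ν → ℝ, (∀ k, ContDiff ℝ ((⊤ : ℕ∞) : WithTop ℕ∞) (φ k)) ∧
    Filter.Tendsto (fun k => eLpNorm (fun x => φ k x - u x) (ENNReal.ofReal p) (volumeOn Ω))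
      Filter.atTop (nhds 0) ∧
    Filter.Tendsto (fun k => eLpNorm (fun x => gradient (φ k) x - G x) (ENNReal.ofReal p)
      (volumeOn Ω)) Filter.atTop (nhds 0) ∧
    Filter.Tendsto (fun k => eLpNorm (fun x => φ k x - g x) (ENNReal.ofReal p) (surfaceMeasure Ω))
      Filter.atTop (nhds 0)

/-- The quotient `(∫_Ω |∇u|^p dx - α ∫_{∂Ω} |u|^p dσ) / ∫_Ω |u|^p dx` of a function `u` with weak
gradient `G` and boundary trace `g`. -/
def quotient {ν : ℕ} (Ω : Set (Space ν)) (p α : ℝ) (u : Space ν → ℝ)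
    (G : Space ν → Space ν) (g : Space ν → ℝ) : ℝ :=
  ((∫ x, ‖G x‖ ^ p ∂volumeOn Ω) - α * ∫ x, |g x| ^ p ∂surfaceMeasure Ω) /
    ∫ x, |u x| ^ p ∂volumeOn Ω

/-- `Λ(Ω, p, α)`: the infimum, in the extended real line, of the quotient over all `u ∈ W^{1,p}(Ω)`
that do not vanish almost everywhere in `Ω`. -/
def Lam {ν : ℕ} (Ω : Set (Space ν)) (p α : ℝ) : EReal :=
  sInf {q : EReal | ∃ (u : Space ν → ℝ) (G : Space ν → Space ν) (g : Space ν → ℝ),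
    MemSobolev Ω p u G ∧ ¬ (u =ᵐ[volumeOn Ω] 0) ∧ IsBoundaryTrace Ω p u G g ∧
      q = ((quotient Ω p α u G g : ℝ) : EReal)}

end Robin

end

namespace Robin

/-! Test with `u x = exp (β ⟪e, x⟫)`, where `e` is a unit vector and `β ^ (p - 1) = α`. Since `‖∇u‖
^ p = β ^ p * |u| ^ p`, the bound follows from `p β ∫_Ω |u| ^ p ≤ ∫_∂Ω |u| ^ p`: the quotient is
then at most `β ^ p - p α β = (1 - p) β ^ p`.

That inequality would follow from the divergence theorem for the field `|u| ^ p • e`, as the normal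
component of `e` is at most 1. Here it comes from slicing instead. Each slice of `Ω` orthogonal to
`e` lies in the projection of the part of `∂Ω` above it, so it has no larger measure
(`slice_measure_le`). Integrating over heights with an exponential weight and applying Tonelli gives
`lintegral_exp_volumeOn_le`. -/

theorem euclideanHausdorffMeasure_image_le {X Y : Type*} [EMetricSpace X] [EMetricSpace Y]
    [MeasurableSpace X] [BorelSpace X] [MeasurableSpace Y] [BorelSpace Y] {K : NNReal} {f : X → Y}
    (hf : LipschitzWith K f) (d : ℕ) (s : Set X) :
    μHE[d] (f '' s) ≤ (K : ENNReal) ^ d * μHE[d] s := by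
  have h := hf.hausdorffMeasure_image_le (Nat.cast_nonneg (α := ℝ) d) s
  rw [ENNReal.rpow_natCast] at h
  simp only [Measure.euclideanHausdorffMeasure_def, Measure.smul_apply, ENNReal.smul_def,
    smul_eq_mul]
  calc _ ≤ _ * ((K : ENNReal) ^ d * μH[d] s) := mul_le_mul_right h _
    _ = _ := by ring

theorem frontier_inter_subset_graph {ν : ℕ} {Ω U : Set (Space ν)} (hΩ : IsOpen Ω) (hU : IsOpen U)
    {e : Space ν} {h : (ℝ ∙ e)ᗮ → ℝ} (hh : Continuous h)
    (hΩU : Ω ∩ U = {y ∈ U | h ((ℝ ∙ e)ᗮ.orthogonalProjectionOnto y) < inner ℝ e y}) :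
    frontier Ω ∩ U ⊆ {y | h ((ℝ ∙ e)ᗮ.orthogonalProjectionOnto y) = inner ℝ e y} := by
  rintro y ⟨hy, hyU⟩
  have hcont : Continuous fun y : Space ν => h ((ℝ ∙ e)ᗮ.orthogonalProjectionOnto y) := by fun_prop
  refine le_antisymm ?_ (not_lt.mp fun hlt => ?_)
  · have hyc : y ∈ closure (Ω ∩ U) := by
      rw [Set.inter_comm]
      exact hU.inter_closure ⟨hyU, frontier_subset_closure hy⟩
    refine closure_minimal (fun z hz => ?_)
      (isClosed_le hcont (by fun_prop : Continuous fun y : Space ν => inner ℝ e y)) hyc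
    rw [hΩU] at hz
    exact hz.2.le
  · have : y ∈ Ω ∩ U := by rw [hΩU]; exact ⟨hyU, hlt⟩
    rw [hΩ.frontier_eq] at hy
    exact hy.2 this.1

theorem finrank_orthogonal_of_norm_eq_one {ν : ℕ} {e : Space ν} (he : ‖e‖ = 1) :
    Module.finrank ℝ (ℝ ∙ e)ᗮ = ν - 1 := by
  have h := (ℝ ∙ e).finrank_add_finrank_orthogonal
  rw [finrank_span_singleton (norm_ne_zero_iff.mp (by rw [he]; exact one_ne_zero)),
    finrank_euclideanSpace_fin] at h
  omega

theorem starProjection_orthogonal_of_norm_eq_one {ν : ℕ} {e : Space ν} (he : ‖e‖ = 1)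
    (y : Space ν) : (ℝ ∙ e)ᗮ.starProjection y = y - (inner ℝ e y : ℝ) • e := by
  rw [Submodule.starProjection_orthogonal_val, Submodule.starProjection_unit_singleton ℝ he]

/-- By compactness it is enough to argue locally, where the boundary lies in the Lipschitz image of
a closed ball of the hyperplane `(ℝ ∙ e)ᗮ`. Finiteness is needed for Tonelli and for integrability
on `∂Ω`. -/
theorem surfaceMeasure_lt_top {ν : ℕ} {Ω : Set (Space ν)} (hΩ : IsBoundedLipschitzDomain Ω) :
    (μHE[ν - 1] : Measure (Space ν)) (frontier Ω) < ⊤ := by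
  have hcpt : IsCompact (frontier Ω) :=
    hΩ.isBounded.isCompact_closure.of_isClosed_subset isClosed_frontier frontier_subset_closure
  refine hcpt.measure_lt_top_of_nhdsWithin fun x hx => ?_
  obtain ⟨e, h, K, U, he, hh, hU, hxU, hΩU⟩ := hΩ.lipschitz x hx
  set P := (ℝ ∙ e)ᗮ.orthogonalProjectionOnto
  have hg : LipschitzWith (1 + K * 1) fun z : (ℝ ∙ e)ᗮ => (z : Space ν) + h z • e := by
    refine LipschitzWith.add (LipschitzWith.subtype_val _) ?_
    refine LipschitzWith.of_dist_le_mul fun z w => ?_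
    rw [dist_eq_norm, ← sub_smul, norm_smul, he, mul_one, mul_one, ← dist_eq_norm]
    exact hh.dist_le_mul z w
  refine ⟨frontier Ω ∩ (U ∩ Metric.ball x 1),
    inter_mem_nhdsWithin _ ((hU.inter Metric.isOpen_ball).mem_nhds
      ⟨hxU, Metric.mem_ball_self one_pos⟩), ?_⟩
  have hsub : frontier Ω ∩ (U ∩ Metric.ball x 1) ⊆
      (fun z : (ℝ ∙ e)ᗮ => (z : Space ν) + h z • e) '' Metric.closedBall (P x) 1 := by
    rintro y ⟨hy, hyU, hyx⟩
    refine ⟨P y, ?_, ?_⟩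
    · rw [Metric.mem_closedBall, dist_eq_norm, ← map_sub]
      refine ((ℝ ∙ e)ᗮ.norm_orthogonalProjectionOnto_apply_le _).trans ?_
      rw [← dist_eq_norm]
      exact (Metric.mem_ball.mp hyx).le
    · have h1 : h (P y) = inner ℝ e y :=
        frontier_inter_subset_graph hΩ.isOpen hU hh.continuous hΩU ⟨hy, hyU⟩
      have h2 : (P y : Space ν) = y - (inner ℝ e y : ℝ) • e :=
        starProjection_orthogonal_of_norm_eq_one he y
      simp only [h1, h2, sub_add_cancel]
  refine (measure_mono hsub).trans_lt
    ((euclideanHausdorffMeasure_image_le hg _ _).trans_lt (ENNReal.mul_lt_top (by simp) ?_))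
  -- In its own dimension, `μHE` on the hyperplane is finite on compact sets.
  rw [← finrank_orthogonal_of_norm_eq_one he]
  exact (isCompact_closedBall (P x) 1).measure_lt_top

/-- A ray from `y` that avoided the frontier would, being connected, stay in `Ω`, which is bounded.
-/
theorem exists_mem_frontier_add_smul {ν : ℕ} {Ω : Set (Space ν)} (hΩ : IsOpen Ω)
    (hb : Bornology.IsBounded Ω) {e : Space ν} (he : ‖e‖ = 1) {y : Space ν} (hy : y ∈ Ω) :
    ∃ t : ℝ, 0 < t ∧ y + t • e ∈ frontier Ω := by
  by_contra! hcon
  have hpre : IsPreconnected ((fun t : ℝ => y + t • e) '' Set.Ici 0) :=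
    isPreconnected_Ici.image _ (by fun_prop)
  have hsub := hpre.subset_of_closure_inter_subset hΩ
    ⟨y, ⟨0, Set.self_mem_Ici, by simp⟩, hy⟩ (by
      rintro _ ⟨hc, t, ht, rfl⟩
      by_contra hn
      rcases (Set.mem_Ici.mp ht).eq_or_lt with rfl | ht
      · exact hn (by simpa using hy)
      · exact hcon t ht (by rw [hΩ.frontier_eq]; exact ⟨hc, hn⟩))
  obtain ⟨R, hR⟩ := hb.exists_norm_le
  have hmem : y + (R + ‖y‖ + 1) • e ∈ Ω :=
    hsub ⟨_, by have := (norm_nonneg y).trans (hR y hy); simp only [Set.mem_Ici]; positivity, rfl⟩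
  have h1 := hR _ hmem
  have h2 : ‖(R + ‖y‖ + 1) • e‖ ≤ ‖y + (R + ‖y‖ + 1) • e‖ + ‖y‖ := by
    simpa using norm_sub_le (y + (R + ‖y‖ + 1) • e) y
  rw [norm_smul, he, mul_one] at h2
  have := le_abs_self (R + ‖y‖ + 1)
  rw [Real.norm_eq_abs] at h2
  linarith

/-- Orthogonal projection onto the hyperplane at height `τ` is 1-Lipschitz, and the ray in direction
`e` from each slice point meets `∂Ω` above it. -/
theorem slice_measure_le {ν : ℕ} {Ω : Set (Space ν)} (hΩ : IsOpen Ω)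
    (hb : Bornology.IsBounded Ω) {e : Space ν} (he : ‖e‖ = 1) (τ : ℝ) :
    (μHE[ν - 1] : Measure (Space ν)) (Ω ∩ {x | inner ℝ e x = τ}) ≤
      surfaceMeasure Ω {x | τ < inner ℝ e x} := by
  have hmeas : MeasurableSet {x : Space ν | τ < inner ℝ e x} :=
    (isOpen_lt continuous_const (by fun_prop)).measurableSet
  have hg : LipschitzWith 1 fun x : Space ν => (ℝ ∙ e)ᗮ.starProjection x + τ • e := by
    refine LipschitzWith.of_dist_le_mul fun x y => ?_
    rw [dist_add_right, dist_eq_norm, ← map_sub, NNReal.coe_one, one_mul, dist_eq_norm]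
    exact (ℝ ∙ e)ᗮ.norm_orthogonalProjectionOnto_apply_le _
  have hsub : Ω ∩ {x | inner ℝ e x = τ} ⊆ (fun x : Space ν => (ℝ ∙ e)ᗮ.starProjection x + τ • e) ''
      ({x | τ < inner ℝ e x} ∩ frontier Ω) := by
    rintro y ⟨hy, rfl⟩
    obtain ⟨t, ht, hyt⟩ := exists_mem_frontier_add_smul hΩ hb he hy
    have hin : (inner ℝ e (y + t • e) : ℝ) = inner ℝ e y + t := by
      rw [inner_add_right, inner_smul_right, real_inner_self_eq_norm_sq, he]; ring
    refine ⟨y + t • e, ⟨?_, hyt⟩, ?_⟩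
    · simp only [Set.mem_ofPred_eq, hin]; linarith
    · simp only [starProjection_orthogonal_of_norm_eq_one he, hin, add_smul]; abel
  rw [surfaceMeasure, Measure.restrict_apply hmeas]
  simpa using (measure_mono hsub).trans (euclideanHausdorffMeasure_image_le hg (ν - 1) _)

theorem map_inner_volumeOn_le {ν : ℕ} {Ω : Set (Space ν)} (hΩ : IsOpen Ω)
    (hb : Bornology.IsBounded Ω) {e : Space ν} (he : ‖e‖ = 1) :
    (volumeOn Ω).map (fun x => inner ℝ e x) ≤
      (volume : Measure ℝ).withDensity fun τ => surfaceMeasure Ω {x | τ < inner ℝ e x} := by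
  have he0 : e ≠ 0 := norm_ne_zero_iff.mp (by rw [he]; exact one_ne_zero)
  have hm : Measurable fun x : Space ν => (inner ℝ e x : ℝ) := by fun_prop
  refine Measure.le_iff.mpr fun B hB => ?_
  rw [Measure.map_apply hm hB, volumeOn, Measure.restrict_apply (hm hB), withDensity_apply _ hB,
    ← EuclideanSpace.euclideanHausdorffMeasure_eq_volume]
  -- Fubini along the hyperplanes orthogonal to `e`.
  have key := EuclideanGeometry.euclideanHausdorffMeasure_eq_lintegral (0 : Space ν) he0
    ((hm hB).inter hΩ.measurableSet)
  have hen : ‖e‖ₑ = 1 := by rw [← ofReal_norm, he, ENNReal.ofReal_one]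
  rw [finrank_euclideanSpace_fin, hen, one_mul] at key
  rw [key, ← lintegral_indicator hB]
  refine lintegral_mono fun τ => ?_
  have hslice : ∀ x : Space ν,
      x ∈ AffineSubspace.mk' (τ • e +ᵥ (0 : Space ν)) (ℝ ∙ e)ᗮ ↔ inner ℝ e x = τ := by
    intro x
    rw [AffineSubspace.mem_mk', Submodule.mem_orthogonal_singleton_iff_inner_right]
    simp [inner_sub_right, inner_smul_right, he, sub_eq_zero]
  by_cases hτ : τ ∈ B
  · rw [Set.indicator_of_mem hτ]
    refine (measure_mono ?_).trans (slice_measure_le hΩ hb he τ)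
    exact fun x hx => ⟨hx.1.2, (hslice x).1 hx.2⟩
  · rw [Set.indicator_of_notMem hτ, nonpos_iff_eq_zero]
    convert measure_empty (μ := (μHE[ν - 1] : Measure (Space ν))) using 2
    ext x
    simp only [Set.mem_inter_iff, Set.mem_preimage, Set.mem_empty_iff_false, iff_false]
    rintro ⟨⟨hxB, -⟩, hx⟩
    exact hτ ((hslice x).1 hx ▸ hxB)

theorem lintegral_Iio_mul_exp {γ : ℝ} (hγ : 0 < γ) (a : ℝ) :
    ∫⁻ τ in Set.Iio a, ENNReal.ofReal (γ * Real.exp (γ * τ)) = ENNReal.ofReal (Real.exp (γ * a)) := by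
  rw [setLIntegral_congr Iio_ae_eq_Iic, ← ofReal_integral_eq_lintegral_ofReal
    ((integrableOn_exp_mul_Iic hγ a).const_mul γ) (Filter.Eventually.of_forall fun τ => by positivity),
    integral_const_mul, integral_exp_mul_Iic hγ, mul_div_cancel₀ _ hγ.ne']

/-- A layer-cake argument: after swapping integrals, the weight `γ * exp (γ * τ)` over heights `τ`
below a boundary point integrates to `exp` at that point. -/
theorem lintegral_exp_volumeOn_le {ν : ℕ} {Ω : Set (Space ν)} (hΩ : IsBoundedLipschitzDomain Ω)
    {e : Space ν} (he : ‖e‖ = 1) {γ : ℝ} (hγ : 0 < γ) :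
    ∫⁻ x, ENNReal.ofReal (γ * Real.exp (γ * inner ℝ e x)) ∂volumeOn Ω ≤
      ∫⁻ x, ENNReal.ofReal (Real.exp (γ * inner ℝ e x)) ∂surfaceMeasure Ω := by
  have : IsFiniteMeasure (surfaceMeasure Ω) :=
    ⟨by simpa [surfaceMeasure] using surfaceMeasure_lt_top hΩ⟩
  set F : ℝ → ENNReal := fun τ => ENNReal.ofReal (γ * Real.exp (γ * τ))
  have hF : Measurable F := by fun_prop
  have hm : Measurable fun x : Space ν => (inner ℝ e x : ℝ) := by fun_prop
  have hS : Measurable fun τ : ℝ => surfaceMeasure Ω {x | τ < inner ℝ e x} :=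
    Antitone.measurable fun a b hab => measure_mono fun x hx => lt_of_le_of_lt hab hx
  have hset : MeasurableSet {q : ℝ × Space ν | q.1 < inner ℝ e q.2} :=
    measurableSet_lt measurable_fst (hm.comp measurable_snd)
  calc ∫⁻ x, F (inner ℝ e x) ∂volumeOn Ω
      = ∫⁻ τ, F τ ∂((volumeOn Ω).map fun x => inner ℝ e x) := (lintegral_map hF hm).symm
    _ ≤ ∫⁻ τ, F τ ∂((volume : Measure ℝ).withDensity
          fun τ => surfaceMeasure Ω {x | τ < inner ℝ e x}) :=
        lintegral_mono' (map_inner_volumeOn_le hΩ.isOpen hΩ.isBounded he) le_rfl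
    _ = ∫⁻ τ, surfaceMeasure Ω {x | τ < inner ℝ e x} * F τ :=
        lintegral_withDensity_eq_lintegral_mul _ hS hF
    _ = ∫⁻ τ, ∫⁻ x, {q : ℝ × Space ν | q.1 < inner ℝ e q.2}.indicator (fun q => F q.1) (τ, x)
          ∂surfaceMeasure Ω := by
        refine lintegral_congr fun τ => ?_
        rw [mul_comm, ← lintegral_indicator_const (measurableSet_lt measurable_const hm)]
        rfl
    _ = ∫⁻ x, (∫⁻ τ, {q : ℝ × Space ν | q.1 < inner ℝ e q.2}.indicator (fun q => F q.1) (τ, x))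
          ∂surfaceMeasure Ω :=
        lintegral_lintegral_swap ((hF.comp measurable_fst).indicator hset).aemeasurable
    _ = ∫⁻ x, ENNReal.ofReal (Real.exp (γ * inner ℝ e x)) ∂surfaceMeasure Ω := by
        refine lintegral_congr fun x => ?_
        rw [← lintegral_Iio_mul_exp hγ, ← lintegral_indicator measurableSet_Iio]
        rfl

theorem memLp_of_continuous {ν : ℕ} {E : Type*} [NormedAddCommGroup E] {s : Set (Space ν)}
    (hs : Bornology.IsBounded s) {μ : Measure (Space ν)} (hμ : μ s < ⊤) (hm : MeasurableSet s)
    {f : Space ν → E} (hf : Continuous f) (q : ENNReal) : MemLp f q (μ.restrict s) := by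
  have : IsFiniteMeasure (μ.restrict s) := ⟨by simpa using hμ⟩
  obtain ⟨C, hC⟩ := (hs.isCompact_closure.image hf).isBounded.exists_norm_le
  exact MemLp.of_bound hf.aestronglyMeasurable C ((ae_restrict_iff' hm).2
    (Filter.Eventually.of_forall fun x hx => hC _ ⟨x, subset_closure hx, rfl⟩))

theorem isWeakGradient_gradient {ν : ℕ} {Ω : Set (Space ν)} {u : Space ν → ℝ}
    (hu : ContDiff ℝ 1 u) : IsWeakGradient Ω u (gradient u) := by
  intro φ hφ hφc hφΩ v
  have hφd : Continuous fun x => fderiv ℝ φ x v :=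
    (hφ.continuous_fderiv (by simp)).clm_apply continuous_const
  have hud : Continuous fun x => fderiv ℝ u x v :=
    (hu.continuous_fderiv (by simp)).clm_apply continuous_const
  have hφc' : HasCompactSupport fun x => fderiv ℝ φ x v := hφc.fderiv_apply ℝ v
  have hinner : ∀ x, (inner ℝ (gradient u x) v : ℝ) = fderiv ℝ u x v := by
    intro x
    simp [gradient, InnerProductSpace.toDual_symm_apply]
  simp only [hinner]
  have h1 : ∫ x, u x * fderiv ℝ φ x v ∂volumeOn Ω = ∫ x, u x * fderiv ℝ φ x v :=
    setIntegral_eq_integral_of_forall_compl_eq_zero fun x hx => by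
      have : fderiv ℝ φ x = 0 := by
        by_contra hne
        exact hx (hφΩ (support_fderiv_subset ℝ hne))
      simp [this]
  have h2 : ∫ x, φ x * fderiv ℝ u x v ∂volumeOn Ω = ∫ x, φ x * fderiv ℝ u x v :=
    setIntegral_eq_integral_of_forall_compl_eq_zero fun x hx => by
      rw [image_eq_zero_of_notMem_tsupport fun h => hx (hφΩ h), zero_mul]
  rw [h1, h2, integral_mul_fderiv_eq_neg_fderiv_mul_of_integrable]
  · simp only [mul_comm]
  · exact (hud.mul hφ.continuous).integrable_of_hasCompactSupport hφc.mul_left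
  · exact (hu.continuous.mul hφd).integrable_of_hasCompactSupport hφc'.mul_left
  · exact (hu.continuous.mul hφ.continuous).integrable_of_hasCompactSupport hφc.mul_left
  · exact fun x _ => hu.differentiable (by simp) x
  · exact fun x _ => hφ.differentiable (by simp) x

theorem gradient_exp_mul_inner {ν : ℕ} (e : Space ν) (β : ℝ) (x : Space ν) :
    gradient (fun x => Real.exp (β * inner ℝ e x)) x =
      (β * Real.exp (β * inner ℝ e x)) • e := by
  refine HasGradientAt.gradient ?_
  rw [hasGradientAt_iff_hasFDerivAt]
  have h := (((innerSL ℝ e).hasFDerivAt (x := x)).const_mul β).exp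
  simp only [innerSL_apply_apply] at h
  refine h.congr_fderiv ?_
  ext v
  simp only [smul_apply, innerSL_apply_apply, InnerProductSpace.toDual_apply_apply,
    real_inner_smul_left, smul_eq_mul]
  ring

end Robin

theorem proposition5p2 {ν : ℕ} (hν : 2 ≤ ν) (Ω : Set (Robin.Space ν))
    (hΩ : Robin.IsBoundedLipschitzDomain Ω) (α : ℝ) (hα : 0 ≤ α) (p : ℝ) (hp : 1 < p) :
    Robin.Lam Ω p α ≤ (((1 - p) * α ^ (p / (p - 1)) : ℝ) : EReal) := by
  have : NeZero ν := ⟨by omega⟩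
  obtain ⟨e, he⟩ : ∃ e : Robin.Space ν, ‖e‖ = 1 := ⟨EuclideanSpace.single 0 1, by simp⟩
  -- This `β` minimizes `β ^ p - p α β` over `β ≥ 0`.
  set β : ℝ := α ^ (1 / (p - 1)) with hβ
  have hβ0 : 0 ≤ β := by positivity
  have hp1 : p - 1 ≠ 0 := by linarith
  set u : Robin.Space ν → ℝ := fun x => Real.exp (β * inner ℝ e x) with hu
  have hus : ContDiff ℝ ((⊤ : ℕ∞) : WithTop ℕ∞) u := by
    exact (contDiff_const.mul (innerSL ℝ e).contDiff).exp
  have hgrad : gradient u = fun x => (β * u x) • e :=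
    funext fun x => Robin.gradient_exp_mul_inner e β x
  have hup : ∀ x, |u x| ^ p = Real.exp (p * β * inner ℝ e x) := by
    intro x
    rw [abs_of_pos (Real.exp_pos _), ← Real.exp_mul]
    ring_nf
  have hGp : ∀ x, ‖gradient u x‖ ^ p = β ^ p * Real.exp (p * β * inner ℝ e x) := by
    intro x
    rw [hgrad, norm_smul, he, mul_one, norm_mul, Real.norm_of_nonneg hβ0, Real.norm_eq_abs,
      Real.mul_rpow hβ0 (abs_nonneg _), hup]
  have hvol : volume Ω < ⊤ := hΩ.isBounded.measure_lt_top
  have hmeas : MeasurableSet Ω := hΩ.isOpen.measurableSet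
  have hfb : Bornology.IsBounded (frontier Ω) :=
    hΩ.isBounded.closure.subset frontier_subset_closure
  have hexp : Continuous fun x : Robin.Space ν => Real.exp (p * β * inner ℝ e x) := by fun_prop
  have hGc : Continuous (gradient u) := by
    rw [hgrad]; fun_prop
  have hintΩ : Integrable (fun x => Real.exp (p * β * inner ℝ e x)) (Robin.volumeOn Ω) :=
    memLp_one_iff_integrable.1 (Robin.memLp_of_continuous hΩ.isBounded hvol hmeas hexp 1)
  have hintF : Integrable (fun x => Real.exp (p * β * inner ℝ e x)) (Robin.surfaceMeasure Ω) :=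
    memLp_one_iff_integrable.1 (Robin.memLp_of_continuous hfb (Robin.surfaceMeasure_lt_top hΩ)
      measurableSet_frontier hexp 1)
  have hne : Robin.volumeOn Ω ≠ 0 := by
    rw [Robin.volumeOn, Ne, Measure.restrict_eq_zero]
    exact (hΩ.isOpen.measure_pos _ hΩ.nonempty).ne'
  have hI : 0 < ∫ x, Real.exp (p * β * inner ℝ e x) ∂(Robin.volumeOn Ω) := by
    have : NeZero (Robin.volumeOn Ω) := ⟨hne⟩
    exact integral_exp_pos hintΩ
  have hkey : p * β * ∫ x, Real.exp (p * β * inner ℝ e x) ∂(Robin.volumeOn Ω) ≤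
      ∫ x, Real.exp (p * β * inner ℝ e x) ∂(Robin.surfaceMeasure Ω) := by
    -- The slicing inequality needs a positive rate; `β = 0` (that is, `α = 0`) is trivial.
    rcases hβ0.eq_or_lt with h0 | hpos
    · rw [← h0, mul_zero, zero_mul]
      exact integral_nonneg fun x => (Real.exp_pos _).le
    · have hγ : 0 < p * β := by positivity
      have h := Robin.lintegral_exp_volumeOn_le hΩ he hγ
      rw [← ofReal_integral_eq_lintegral_ofReal (hintΩ.const_mul _)
          (Filter.Eventually.of_forall fun x => by positivity),
        ← ofReal_integral_eq_lintegral_ofReal hintF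
          (Filter.Eventually.of_forall fun x => (Real.exp_pos _).le),
        ENNReal.ofReal_le_ofReal_iff (integral_nonneg fun x => (Real.exp_pos _).le),
        integral_const_mul] at h
      exact h
  have hβp1 : β ^ (p - 1) = α := by
    rw [hβ, ← Real.rpow_mul hα, one_div_mul_cancel hp1, Real.rpow_one]
  have hβp : β ^ p = α ^ (p / (p - 1)) := by
    rw [hβ, ← Real.rpow_mul hα]; ring_nf
  have hαβ : α * β = β ^ p := by
    nth_rewrite 1 [← hβp1]
    rw [← Real.rpow_add_one' hβ0 (by linarith), sub_add_cancel]
  have hsob : Robin.MemSobolev Ω p u (gradient u) :=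
    ⟨Robin.memLp_of_continuous hΩ.isBounded hvol hmeas hus.continuous _,
      Robin.memLp_of_continuous hΩ.isBounded hvol hmeas hGc _,
      Robin.isWeakGradient_gradient (hus.of_le (by simp))⟩
  -- As `u` is smooth on the whole space, the constant sequence approximates it.
  have htrace : Robin.IsBoundaryTrace Ω p u (gradient u) u :=
    ⟨Robin.memLp_of_continuous hfb (Robin.surfaceMeasure_lt_top hΩ) measurableSet_frontier
      hus.continuous _, fun _ => u, fun _ => hus, by simp, by simp, by simp⟩
  have hu0 : ¬ u =ᵐ[Robin.volumeOn Ω] 0 := by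
    intro h0
    have : (ae (Robin.volumeOn Ω)).NeBot := ae_neBot.2 hne
    obtain ⟨x, hx⟩ := h0.exists
    exact (Real.exp_pos _).ne' hx
  have hle : Robin.Lam Ω p α ≤ (Robin.quotient Ω p α u (gradient u) u : EReal) :=
    sInf_le ⟨u, gradient u, u, hsob, hu0, htrace, rfl⟩
  refine hle.trans ?_
  rw [EReal.coe_le_coe_iff, Robin.quotient]
  simp only [hup, hGp, integral_const_mul]
  rw [div_le_iff₀ hI, ← hβp]
  have := mul_le_mul_of_nonneg_left hkey hα
  rw [← hαβ]
  linarith
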